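/- Let $(\mathcal X,d_{\mathcal X})$ be a compact metric space and $\omega$ a nonzero finite Borel measure on $\mathcal X$. A measurable map $F:\mathcal X\to\mathcal X$ is nonsingular if $\omega(E)=0$ implies $\omega(F^{-1}(E))=0$; $\mathcal K_F g=g\circ F$ denotes its Koopman operator on $L^2(\mathcal X,\omega)$, and $$\mathrm{Sp}_{\mathrm{ap}}(\mathcal K_F)=\{\lambda\in\mathbb C:\exists\, g_n\in L^2(\mathcal X,\omega),\ \|g_n\|=1,\ \lim_{n\to\infty}\|(\mathcal K_F-\lambda I)g_n\|=0\}.$$ For a nondecreasing continuous $\alpha:\mathbb R_{\ge0}\to\mathbb R_{\ge0}$ with $\alpha(0)=0$, let - $\Omega^{\alpha}_{\mathcal X}$ be the set of nonsingular $F$ with $\mathcal K_F$ bounded and $d_{\mathcal X}(F(x),F(y))\le\alpha(d_{\mathcal X}(x,y))$ for all $x,y\in\mathcal X$; - $\Omega^{m}_{\mathcal X}$ be the set of continuous $F$ that preserve $\omega$; - $\Omega_{\mathcal X}$ be the set of continuous nonsingular $F$ with $\mathcal K_F$ bounded. Snapshot data for $F$ is a family $y=(y_{x,n})_{x\in\mathcal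 X,n\in\mathbb N}$ in $\mathcal X$ with $d_{\mathcal X}(F(x),y_{x,n})\le 2^{-n}$ for all $x,n$. A (deterministic, general) algorithm for a class $\Omega$ of maps is a function $\Gamma$ that assigns to snapshot data of maps in $\Omega$ a nonempty compact subset of $\mathbb C$, such that to every input $y$ there belongs a nonempty finite set $Q(y)\subset\mathcal X\times\mathbb N$ with the following property: if $y'$ is another input with $y'_{x,n}=y_{x,n}$ for all $(x,n)\in Q(y)$, then $Q(y')=Q(y)$ and $\Gamma(y')=\Gamma(y)$. All limits below are in the Hausdorff metric on nonempty compact subsets of $\mathbb C$, and $B_r(0)\subset\mathbb C$ is the closed ball. For every $F$ in the classes above, $\mathrm{Sp}_{\mathrm{ap}}(\mathcal K_F)$ is a nonempty compact set, and the following hold. 1. (Two limits, $\Pi_2$.) For every such $\alpha$ there are algorithms $\Gamma_{n_2,n_1}$ ($n_1,n_2\in\mathbb N$) for $\Omega^\alpha_{\mathcal X}$ such that for all $F\in\Omega^\alpha_{\mathcal X}$ and all snapshot data $y$ for $F$ the limits $\Gamma_{n_2}(y)=\lim_{n_1\to\infty}\Gamma_{n_2,n_1}(y)$ exist, $\lim_{n_2\to\infty}\Gamma_{n_2}(y)=\mathrm{Sp}_{\mathrm{ap}}(\mathcal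 K_F)$, and $\mathrm{Sp}_{\mathrm{ap}}(\mathcal K_F)\subset\Gamma_{n_2}(y)+B_{2^{-n_2}}(0)$ for all $n_2$. 2. (Two limits, $\Sigma_2$.) There are algorithms $\Gamma_{n_2,n_1}$ for $\Omega^m_{\mathcal X}$ such that for all $F\in\Omega^m_{\mathcal X}$ and all snapshot data $y$ for $F$ the limits $\Gamma_{n_2}(y)=\lim_{n_1\to\infty}\Gamma_{n_2,n_1}(y)$ exist, $\lim_{n_2\to\infty}\Gamma_{n_2}(y)=\mathrm{Sp}_{\mathrm{ap}}(\mathcal K_F)$, and $\Gamma_{n_2}(y)\subset\mathrm{Sp}_{\mathrm{ap}}(\mathcal K_F)+B_{2^{-n_2}}(0)$ for all $n_2$. 3. (Three limits, $\Pi_3$.) There are algorithms $\Gamma_{n_3,n_2,n_1}$ for $\Omega_{\mathcal X}$ such that for all $F\in\Omega_{\mathcal X}$ and all snapshot data $y$ for $F$ the limits $\Gamma_{n_3,n_2}(y)=\lim_{n_1\to\infty}\Gamma_{n_3,n_2,n_1}(y)$ and $\Gamma_{n_3}(y)=\lim_{n_2\to\infty}\Gamma_{n_3,n_2}(y)$ exist,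 $\lim_{n_3\to\infty}\Gamma_{n_3}(y)=\mathrm{Sp}_{\mathrm{ap}}(\mathcal K_F)$, and $\mathrm{Sp}_{\mathrm{ap}}(\mathcal K_F)\subset\Gamma_{n_3}(y)+B_{2^{-n_3}}(0)$ for all $n_3$. -/

import Mathlib

open MeasureTheory Filter Topology TopologicalSpace
open scoped NNReal Pointwise

namespace KoopmanSCI

section Koopman

variable {X : Type*} [MeasurableSpace X]

/-- `K` is the Koopman operator of `F`: a bounded operator on `L²(X, ω)` acting by `g ↦ g ∘ F`. -/
def IsKoopman (F : X → X) (ω : Measure X) (K : Lp ℂ 2 ω →L[ℂ] Lp ℂ 2 ω) : Prop :=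
  ∀ g : Lp ℂ 2 ω, (K g : X → ℂ) =ᵐ[ω] (g : X → ℂ) ∘ F

/-- Composition with `F` is a bounded operator from `L²(X, ω)` to itself. -/
def KoopmanBounded (F : X → X) (ω : Measure X) : Prop :=
  ∃ K : Lp ℂ 2 ω →L[ℂ] Lp ℂ 2 ω, IsKoopman F ω K

open Classical in
/-- The Koopman operator of `F` on `L²(X, ω)` (with the value `0` if it is not bounded). -/
noncomputable def koopman (F : X → X) (ω : Measure X) : Lp ℂ 2 ω →L[ℂ] Lp ℂ 2 ω :=
  if h : KoopmanBounded F ω then h.choose else 0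

theorem koopman_spec {F : X → X} {ω : Measure X} (h : KoopmanBounded F ω) :
    IsKoopman F ω (koopman F ω) := by
  rw [koopman, dif_pos h]
  exact h.choose_spec

theorem IsKoopman.eq_koopman {F : X → X} {ω : Measure X} {K : Lp ℂ 2 ω →L[ℂ] Lp ℂ 2 ω}
    (hK : IsKoopman F ω K) : K = koopman F ω := by
  ext1 g
  exact Lp.ext ((hK g).trans (koopman_spec ⟨K, hK⟩ g).symm)

theorem koopmanBounded_of_measurePreserving {F : X → X} {ω : Measure X}
    (hF : MeasurePreserving F ω ω) : KoopmanBounded F ω :=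
  ⟨(Lp.compMeasurePreservingₗᵢ ℂ F hF).toContinuousLinearMap,
    fun g => Lp.coeFn_compMeasurePreserving g hF⟩

end Koopman

/-- The approximate point spectrum of a bounded operator. -/
def approxPointSpectrum {H : Type*} [NormedAddCommGroup H] [NormedSpace ℂ H]
    (K : H →L[ℂ] H) : Set ℂ :=
  {z | ∃ g : ℕ → H, (∀ n, ‖g n‖ = 1) ∧ Tendsto (fun n => ‖K (g n) - z • g n‖) atTop (𝓝 0)}

section Classes

variable {X : Type*} [MetricSpace X] [MeasurableSpace X]

/-- Continuous nonsingular maps with bounded Koopman operator. -/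
def ContinuousClass (ω : Measure X) : Set (X → X) :=
  {F | Continuous F ∧ Measure.QuasiMeasurePreserving F ω ω ∧ KoopmanBounded F ω}

/-- Nonsingular maps with modulus of continuity `α` and bounded Koopman operator. -/
def ModulusClass (ω : Measure X) (α : ℝ≥0 → ℝ≥0) : Set (X → X) :=
  {F | (∀ x y, nndist (F x) (F y) ≤ α (nndist x y)) ∧
    Measure.QuasiMeasurePreserving F ω ω ∧ KoopmanBounded F ω}

/-- Continuous measure-preserving maps. -/
def MeasurePreservingClass (ω : Measure X) : Set (X → X) :=
  {F | Continuous F ∧ MeasurePreserving F ω ω}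

end Classes

section Algorithms

variable {X : Type*} [MetricSpace X]

/-- `y` is snapshot data for `F` to arbitrary precision: `y x n` is a measurement of `F x` with
error at most `2⁻ⁿ`. -/
def IsSnapshotData (F : X → X) (y : X → ℕ → X) : Prop :=
  ∀ x n, dist (F x) (y x n) ≤ (1 / 2 : ℝ) ^ n

/-- All snapshot data of all maps in the class `Ω`: the inputs that an algorithm has to handle. -/
def snapshotInputs (Ω : Set (X → X)) : Set (X → ℕ → X) :=
  {y | ∃ F ∈ Ω, IsSnapshotData F y}

/-- `Γ` is a deterministic (general) algorithm on the snapshot data of the class `Ω`: on each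
input `y` it reads a nonempty finite set `Q y` of measurements, and on two inputs that agree on
the measurements read from the first of them it reads the same measurements and gives the same
output. -/
def IsGeneralAlgorithm {M : Type*} (Ω : Set (X → X)) (Γ : (X → ℕ → X) → M) : Prop :=
  ∃ Q : (X → ℕ → X) → Finset (X × ℕ), ∀ y ∈ snapshotInputs Ω, (Q y).Nonempty ∧
    ∀ y' ∈ snapshotInputs Ω, (∀ q ∈ Q y, y q.1 q.2 = y' q.1 q.2) → Q y = Q y' ∧ Γ y = Γ y'

end Algorithms

end KoopmanSCI

namespace KoopmanSCI

/-! ### Hausdorff convergence. -/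

section Hausdorff

/-! Call `z` a `c`-pseudoeigenvalue if `‖K g - z • g‖ < c * ‖g‖` for some `g`. The approximate point
spectrum is the intersection over `c > 0` of these sets, and by compactness they shrink to it
(`exists_pseudoEigenvalue_close`). The grid points that are `2⁻ᵐ`-pseudoeigenvalues therefore cover
the spectrum up to `2⁻ᵐ` and converge to it. This is the last limit for the two classes with
covering from above.

With a known modulus of continuity one further limit finds these grid points: accept a point when it
is a pseudoeigenvalue for every map compatible with the data. The true map is compatible, so nothing
false is accepted; compatible maps become uniformly close to it, and a pseudoeigenvalue survives
uniform perturbation (`isPseudoEigenvalue_of_uniformly_close`).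

Without a modulus, residuals of continuous functions are limits of quadratures
(`tendsto_quadResidual`), with no known rate. Claims of the form "from stage `N` on, these
inequalities hold" are refutable, so a valid one is found in one limit (`exists_limit_search`). A
second limit exhausts the test functions, a third refines the grid.

For measure-preserving maps `K` is an isometry, and a `c`-pseudoeigenvalue is within `c` of the
spectrum (`exists_dist_lt_of_isometry`). A small residual is then an error bound, so one limit
yields a finite set certified from below, and the last limit makes it exhaustive. -/

theorem tendsto_nonemptyCompacts_of_dist {E : Type*} [MetricSpace E] {G : ℕ → NonemptyCompacts E}
    {S : NonemptyCompacts E}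
    (h₁ : ∀ ε > 0, ∀ᶠ n in atTop, ∀ x ∈ G n, ∃ z ∈ S, dist x z ≤ ε)
    (h₂ : ∀ z ∈ S, ∀ ε > 0, ∀ᶠ n in atTop, ∃ x ∈ G n, dist z x ≤ ε) :
    Tendsto G atTop (𝓝 S) := by
  rw [Metric.tendsto_nhds]
  intro ε hε
  -- A finite net of `S` makes the pointwise hypothesis `h₂` uniform.
  obtain ⟨t, htS, htf, hcov⟩ := S.isCompact.finite_cover_balls (e := ε / 4) (by positivity)
  have h₃ : ∀ᶠ n in atTop, ∀ z ∈ t, ∃ x ∈ G n, dist z x ≤ ε / 4 :=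
    (htf.eventually_all).2 fun z hz => h₂ z (htS hz) _ (by positivity)
  filter_upwards [h₁ (ε / 2) (by positivity), h₃] with n hn₁ hn₃
  rw [Metric.NonemptyCompacts.dist_eq]
  refine lt_of_le_of_lt (Metric.hausdorffDist_le_of_mem_dist (r := ε / 2) (by positivity) hn₁ ?_)
    (by linarith)
  intro z hz
  obtain ⟨w, hw, hzw⟩ := Set.mem_iUnion₂.1 (hcov hz)
  obtain ⟨x, hx, hwx⟩ := hn₃ w hw
  refine ⟨x, hx, ?_⟩
  have := dist_triangle z w x
  rw [Metric.mem_ball] at hzw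
  linarith

end Hausdorff

/-! ### Pseudoeigenvalues and the approximate point spectrum. -/

section Operators

variable {H : Type*} [NormedAddCommGroup H] [NormedSpace ℂ H] {K : H →L[ℂ] H}

/-- `z` lies in the `c`-approximate point pseudospectrum of `K`. -/
def IsPseudoEigenvalue (K : H →L[ℂ] H) (z : ℂ) (c : ℝ) : Prop :=
  ∃ g : H, ‖K g - z • g‖ < c * ‖g‖

theorem mem_approxPointSpectrum_iff {z : ℂ} :
    z ∈ approxPointSpectrum K ↔ ∀ c > 0, IsPseudoEigenvalue K z c := by
  constructor
  · rintro ⟨g, hg, hlim⟩ c hc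
    obtain ⟨n, hn⟩ := (hlim.eventually (gt_mem_nhds hc)).exists
    exact ⟨g n, by rwa [hg n, mul_one]⟩
  · intro h
    choose g hg using fun n : ℕ => h (1 / ((n : ℝ) + 1)) Nat.one_div_pos_of_nat
    have hpos : ∀ n, 0 < ‖g n‖ := by
      intro n
      by_contra! h0
      have h1 : g n = 0 := norm_le_zero_iff.1 h0
      have := hg n
      simp [h1] at this
    refine ⟨fun n => ((‖g n‖⁻¹ : ℝ) : ℂ) • g n, fun n => ?_, ?_⟩
    · rw [norm_smul, Complex.norm_real, norm_inv, norm_norm, inv_mul_cancel₀ (hpos n).ne']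
    · refine squeeze_zero (fun n => norm_nonneg _) (fun n => ?_)
        tendsto_one_div_add_atTop_nhds_zero_nat
      rw [map_smul, smul_comm z, ← smul_sub, norm_smul, Complex.norm_real, norm_inv, norm_norm,
        inv_mul_le_iff₀ (hpos n), mul_comm]
      exact (hg n).le

theorem IsPseudoEigenvalue.norm_lt {z : ℂ} {c : ℝ} (h : IsPseudoEigenvalue K z c) :
    ‖z‖ < ‖K‖ + c := by
  obtain ⟨g, hg⟩ := h
  have h1 : ‖z‖ * ‖g‖ < (‖K‖ + c) * ‖g‖ := by
    calc ‖z‖ * ‖g‖ = ‖K g - (K g - z • g)‖ := by rw [sub_sub_cancel, norm_smul]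
      _ ≤ ‖K g‖ + ‖K g - z • g‖ := norm_sub_le _ _
      _ < ‖K‖ * ‖g‖ + c * ‖g‖ := add_lt_add_of_le_of_lt (K.le_opNorm g) hg
      _ = _ := by ring
  exact lt_of_mul_lt_mul_right h1 (norm_nonneg g)

theorem IsPseudoEigenvalue.add_dist {z w : ℂ} {c : ℝ} (h : IsPseudoEigenvalue K z c) :
    IsPseudoEigenvalue K w (c + dist z w) := by
  obtain ⟨g, hg⟩ := h
  refine ⟨g, ?_⟩
  calc ‖K g - w • g‖ = ‖(K g - z • g) + (z - w) • g‖ := by congr 1; module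
    _ ≤ ‖K g - z • g‖ + ‖(z - w) • g‖ := norm_add_le _ _
    _ < c * ‖g‖ + dist z w * ‖g‖ := by
        rw [norm_smul, ← dist_eq_norm z w]; gcongr
    _ = _ := by ring

theorem IsPseudoEigenvalue.mono {z : ℂ} {c d : ℝ} (h : IsPseudoEigenvalue K z c) (hcd : c ≤ d) :
    IsPseudoEigenvalue K z d := by
  obtain ⟨g, hg⟩ := h
  exact ⟨g, hg.trans_le (by gcongr)⟩

theorem isPseudoEigenvalue_of_dist_lt {z w : ℂ} {c : ℝ} (hz : z ∈ approxPointSpectrum K)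
    (h : dist z w < c) : IsPseudoEigenvalue K w c := by
  have := (mem_approxPointSpectrum_iff.1 hz (c - dist z w) (by linarith)).add_dist (w := w)
  rwa [sub_add_cancel] at this

theorem isCompact_approxPointSpectrum (K : H →L[ℂ] H) : IsCompact (approxPointSpectrum K) := by
  refine Metric.isCompact_of_isClosed_isBounded ?_ ?_
  · refine isClosed_of_closure_subset fun w hw => mem_approxPointSpectrum_iff.2 fun c hc => ?_
    obtain ⟨z, hz, hwz⟩ := Metric.mem_closure_iff.1 hw c hc
    exact isPseudoEigenvalue_of_dist_lt hz (by rwa [dist_comm])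
  · refine (Metric.isBounded_closedBall (x := (0 : ℂ)) (r := ‖K‖ + 1)).subset fun z hz => ?_
    rw [mem_closedBall_zero_iff]
    exact (mem_approxPointSpectrum_iff.1 hz 1 one_pos).norm_lt.le

/-- Counterexamples for `δ = 1 / (n + 1)` stay in a fixed ball, and any accumulation point of them
lies in the spectrum. The argument gives no rate for `δ`. -/
theorem exists_pseudoEigenvalue_close (K : H →L[ℂ] H) {ε : ℝ} (hε : 0 < ε) :
    ∃ δ > 0, ∀ z, IsPseudoEigenvalue K z δ → ∃ w ∈ approxPointSpectrum K, dist z w < ε := by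
  by_contra! hcon
  choose z hz hfar using fun n : ℕ => hcon (1 / ((n : ℝ) + 1)) Nat.one_div_pos_of_nat
  have hb : ∀ n, z n ∈ Metric.closedBall (0 : ℂ) (‖K‖ + 1) := by
    intro n
    rw [mem_closedBall_zero_iff]
    refine ((hz n).mono ?_).norm_lt.le
    rw [div_le_one (by positivity)]
    linarith [(Nat.cast_nonneg n : (0 : ℝ) ≤ n)]
  obtain ⟨w, -, φ, hφ, hlim⟩ := (isCompact_closedBall (0 : ℂ) (‖K‖ + 1)).tendsto_subseq hb
  have hdist : Tendsto (fun n => dist (z (φ n)) w) atTop (𝓝 0) :=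
    tendsto_iff_dist_tendsto_zero.1 hlim
  have hw : w ∈ approxPointSpectrum K := by
    refine mem_approxPointSpectrum_iff.2 fun c hc => ?_
    have h0 := (tendsto_one_div_add_atTop_nhds_zero_nat (𝕜 := ℝ)).comp hφ.tendsto_atTop
    have hsum := h0.add hdist
    rw [add_zero] at hsum
    obtain ⟨n, hn⟩ := (hsum.eventually (gt_mem_nhds hc)).exists
    exact ((hz (φ n)).add_dist (w := w)).mono hn.le
  obtain ⟨n, hn⟩ := (hdist.eventually (gt_mem_nhds hε)).exists
  exact absurd hn (not_lt.2 (hfar (φ n) w hw))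

end Operators

/-! ### Isometries: a small residual bounds the distance to the spectrum. -/

section Isometries

variable {H : Type*} [NormedAddCommGroup H] [InnerProductSpace ℂ H] {K : H →L[ℂ] H}

/-- Pythagoras: all terms after the first sum to an element of the range of `K`, to which `v` is
orthogonal. -/
theorem norm_sq_sum_range_of_wandering (hK : ∀ g, ‖K g‖ = ‖g‖) {v : H}
    (hv : ∀ g, inner ℂ v (K g) = 0) (a : ℂ) (ha : ‖a‖ = 1) (n : ℕ) :
    ‖∑ k ∈ Finset.range n, a ^ k • (K ^ k) v‖ ^ 2 = n * ‖v‖ ^ 2 := by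
  induction n with
  | zero => simp
  | succ n ih =>
    have hsum : ∑ k ∈ Finset.range (n + 1), a ^ k • (K ^ k) v =
        v + K (a • ∑ k ∈ Finset.range n, a ^ k • (K ^ k) v) := by
      rw [Finset.sum_range_succ', add_comm, Finset.smul_sum, map_sum]
      congr 1
      · simp
      · refine Finset.sum_congr rfl fun k _ => ?_
        rw [smul_smul, map_smul, pow_succ' a, pow_succ' K, mul_apply_eq_comp]
    rw [hsum, sq, norm_add_sq_eq_norm_sq_add_norm_sq_of_inner_eq_zero _ _ (hv _), hK, norm_smul, ha,
      one_mul, ← sq, ← sq, ih]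
    push_cast
    ring

variable [CompleteSpace H]

/-- If `K - z` is bounded below it is injective, and by normality its range has zero orthogonal
complement, so it is invertible. -/
theorem mem_approxPointSpectrum_of_mem_spectrum (hK : IsStarNormal K) {z : ℂ}
    (hz : z ∈ spectrum ℂ K) : z ∈ approxPointSpectrum K := by
  refine mem_approxPointSpectrum_iff.2 fun c hc => ?_
  by_contra hcon
  simp only [IsPseudoEigenvalue, not_exists, not_lt] at hcon
  refine hz ?_
  rw [spectrum.mem_resolventSet_iff, ← IsUnit.neg_iff, neg_sub]
  set T : H →L[ℂ] H := K - algebraMap ℂ (H →L[ℂ] H) z with hT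
  have hTapply : ∀ g, T g = K g - z • g := fun g => by
    simp [hT, Algebra.algebraMap_eq_smul_one]
  have hTn : IsStarNormal T := by
    constructor
    have h1 : Commute (star K) K := hK.star_comm_self
    rw [hT, star_sub, ← algebraMap_star_comm]
    exact (h1.sub_left (Algebra.commutes _ _)).sub_right
      ((Algebra.commutes z _).symm)
  have hanti : AntilipschitzWith (Real.toNNReal c⁻¹) T := by
    refine AddMonoidHomClass.antilipschitz_of_bound T fun g => ?_
    rw [Real.coe_toNNReal _ (by positivity), hTapply, le_inv_mul_iff₀ hc]
    exact hcon g
  rw [ContinuousLinearMap.isUnit_iff_bijective,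
    ContinuousLinearMap.bijective_iff_dense_range_and_antilipschitz]
  refine ⟨?_, _, hanti⟩
  rw [Submodule.topologicalClosure_eq_top_iff, ContinuousLinearMap.IsStarNormal.orthogonal_range hTn]
  exact LinearMap.ker_eq_bot.2 hanti.injective

/-- The resolvent at `z` is normal, so its norm is attained as `‖k‖` by some `k` in its spectrum;
then `z - k⁻¹` is a spectral point of `K`, and the residual bound forces `‖k‖⁻¹ < c`. -/
theorem exists_dist_lt_of_isStarNormal (hK : IsStarNormal K) {z : ℂ} {c : ℝ}
    (h : IsPseudoEigenvalue K z c) : ∃ w ∈ approxPointSpectrum K, dist z w < c := by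
  obtain ⟨g, hg⟩ := h
  have hgpos : 0 < ‖g‖ := by
    by_contra! h0
    rw [norm_le_zero_iff.1 h0] at hg
    simp at hg
  have hc : 0 < c := pos_of_mul_pos_left ((norm_nonneg _).trans_lt hg) hgpos.le
  have : Nontrivial H := ⟨g, 0, norm_pos_iff.1 hgpos⟩
  by_cases hz : z ∈ spectrum ℂ K
  · exact ⟨z, mem_approxPointSpectrum_of_mem_spectrum hK hz, by rwa [dist_self]⟩
  rw [spectrum.notMem_iff] at hz
  obtain ⟨u, hu⟩ := hz
  have hun : IsStarNormal (u : H →L[ℂ] H) := by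
    constructor
    have h1 : Commute (star K) K := hK.star_comm_self
    rw [hu, star_sub, ← algebraMap_star_comm]
    have h2 : ∀ (w : ℂ) (T : H →L[ℂ] H), Commute (algebraMap ℂ (H →L[ℂ] H) w) T := Algebra.commutes
    exact ((h2 _ _).sub_right (h2 _ _)).sub_left ((h2 _ _).symm.sub_right h1)
  have hinv : IsStarNormal ((u⁻¹ : (H →L[ℂ] H)ˣ) : H →L[ℂ] H) := by
    have hun' : Commute (star u) u := by
      apply Units.ext
      exact hun.star_comm_self
    constructor
    have := congrArg (Units.val) (hun'.inv_inv).eq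
    rw [commute_iff_eq]
    simpa only [Units.val_mul, ← star_inv, Units.coe_star] using this
  obtain ⟨k, hk, hknorm⟩ := spectrum.exists_nnnorm_eq_spectralRadius
    ((u⁻¹ : (H →L[ℂ] H)ˣ) : H →L[ℂ] H)
  rw [IsStarNormal.spectralRadius_eq_nnnorm, ENNReal.coe_inj] at hknorm
  have hknorm' : ‖k‖ = ‖((u⁻¹ : (H →L[ℂ] H)ˣ) : H →L[ℂ] H)‖ := congrArg NNReal.toReal hknorm
  have hbound : ‖g‖ < ‖k‖ * (c * ‖g‖) := by
    have hug : (u : H →L[ℂ] H) g = -(K g - z • g) := by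
      rw [hu]
      simp [Algebra.algebraMap_eq_smul_one]
    have hgg : ((u⁻¹ : (H →L[ℂ] H)ˣ) : H →L[ℂ] H) ((u : H →L[ℂ] H) g) = g := by
      rw [← mul_apply_eq_comp, Units.inv_mul, one_apply_eq_self]
    have hle := ContinuousLinearMap.le_opNorm ((u⁻¹ : (H →L[ℂ] H)ˣ) : H →L[ℂ] H)
      ((u : H →L[ℂ] H) g)
    rw [hgg, hug, norm_neg, ← hknorm'] at hle
    have hkpos : 0 < ‖k‖ := by
      by_contra! h0
      have : ‖k‖ = 0 := le_antisymm h0 (norm_nonneg _)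
      rw [this, zero_mul] at hle
      linarith
    exact hle.trans_lt (by gcongr)
  have hkc : 1 < ‖k‖ * c := by
    rw [← mul_assoc] at hbound
    exact lt_of_mul_lt_mul_right (by linarith) hgpos.le
  have hk0 : k ≠ 0 := by
    rintro rfl
    simp at hkc
    linarith
  refine ⟨z - k⁻¹, mem_approxPointSpectrum_of_mem_spectrum hK ?_, ?_⟩
  · have h1 : k⁻¹ ∈ spectrum ℂ (u : H →L[ℂ] H) := by
      have := (spectrum.inv_mem_iff (R := ℂ) (r := Units.mk0 k hk0) (a := u⁻¹)).1 hk
      simpa using this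
    rw [hu] at h1
    rw [spectrum.mem_iff] at h1 ⊢
    rw [← IsUnit.neg_iff] at h1
    convert h1 using 2
    rw [map_sub]
    abel
  · rw [dist_eq_norm, sub_sub_cancel, norm_inv]
    rw [inv_lt_iff_one_lt_mul₀ (norm_pos_iff.2 hk0)]
    linarith

theorem isStarNormal_of_isometry_of_surjective (hK : ∀ g, ‖K g‖ = ‖g‖)
    (hs : Function.Surjective K) : IsStarNormal K := by
  rw [ContinuousLinearMap.isStarNormal_iff_norm_eq_adjoint]
  intro v
  obtain ⟨w, rfl⟩ := hs v
  have h1 := (ContinuousLinearMap.norm_map_iff_adjoint_comp_self K).1 hK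
  have h2 : ContinuousLinearMap.adjoint K (K w) = w := by
    simpa using congrArg (fun T : H →L[ℂ] H => T w) h1
  rw [hK, h2, hK]

/-- Take `v ≠ 0` orthogonal to the closed proper range. The sum of `z⁻ᵏ Kᵏ v` over `k < n` has norm
`√n ‖v‖`, while `K - z` telescopes it to norm at most `2 ‖v‖`. -/
theorem mem_approxPointSpectrum_of_not_surjective (hK : ∀ g, ‖K g‖ = ‖g‖)
    (hs : ¬ Function.Surjective K) {z : ℂ} (hz : ‖z‖ = 1) : z ∈ approxPointSpectrum K := by
  have hiso : Isometry K := AddMonoidHomClass.isometry_of_norm K hK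
  have hclosed : IsClosed (K.range : Set H) := by
    rw [LinearMap.coe_range]
    exact hiso.isClosedEmbedding.isClosed_range
  have : CompleteSpace K.range := hclosed.completeSpace_coe
  obtain ⟨v, hv, hv0⟩ : ∃ v ∈ K.rangeᗮ, v ≠ 0 := by
    refine Submodule.exists_mem_ne_zero_of_ne_bot fun hbot => hs ?_
    rw [Submodule.orthogonal_eq_bot_iff] at hbot
    exact LinearMap.range_eq_top.1 hbot
  have hvK : ∀ g, inner ℂ v (K g) = 0 := fun g =>
    Submodule.inner_left_of_mem_orthogonal (LinearMap.mem_range_self _ g) hv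
  have hvpos : 0 < ‖v‖ := norm_pos_iff.2 hv0
  have hz0 : z ≠ 0 := by
    rintro rfl
    simp at hz
  refine mem_approxPointSpectrum_iff.2 fun c hc => ?_
  obtain ⟨n, hn⟩ := exists_nat_gt ((2 / c) ^ 2)
  have ha : ‖z⁻¹‖ = 1 := by rw [norm_inv, hz, inv_one]
  refine ⟨∑ k ∈ Finset.range n, z⁻¹ ^ k • (K ^ k) v, ?_⟩
  have hnorm := norm_sq_sum_range_of_wandering hK hvK z⁻¹ ha n
  have hKpow : ∀ k, ‖(K ^ k) v‖ = ‖v‖ := by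
    intro k
    induction k with
    | zero => simp
    | succ k ih => rw [pow_succ', mul_apply_eq_comp, hK, ih]
  have htel : K (∑ k ∈ Finset.range n, z⁻¹ ^ k • (K ^ k) v) -
      z • ∑ k ∈ Finset.range n, z⁻¹ ^ k • (K ^ k) v = z • (z⁻¹ ^ n • (K ^ n) v - v) := by
    have h1 : ∀ k, K (z⁻¹ ^ k • (K ^ k) v) = z • (z⁻¹ ^ (k + 1) • (K ^ (k + 1)) v) := by
      intro k
      rw [map_smul, smul_smul, pow_succ' K, mul_apply_eq_comp, pow_succ',
        mul_inv_cancel_left₀ hz0]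
    rw [map_sum, Finset.sum_congr rfl fun k _ => h1 k, ← Finset.smul_sum, ← smul_sub,
      ← Finset.sum_sub_distrib, Finset.sum_range_sub (fun k => z⁻¹ ^ k • (K ^ k) v)]
    simp
  rw [htel, norm_smul, hz, one_mul]
  have hle : ‖z⁻¹ ^ n • (K ^ n) v - v‖ ≤ 2 * ‖v‖ := by
    refine (norm_sub_le _ _).trans ?_
    rw [norm_smul, norm_pow, ha, one_pow, one_mul, hKpow]
    linarith
  refine hle.trans_lt (lt_of_pow_lt_pow_left₀ 2 (by positivity) ?_)
  rw [mul_pow, mul_pow, hnorm, ← mul_assoc]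
  have h2 : (2 : ℝ) ^ 2 < c ^ 2 * n := by
    rw [div_pow, div_lt_iff₀ (by positivity)] at hn
    linarith
  gcongr

/-- A surjective isometry is normal. Otherwise the whole unit circle is in the spectrum, and the
residual is at least `|1 - ‖z‖| * ‖g‖`, where `|1 - ‖z‖|` is the distance from `z` to the circle. -/
theorem exists_dist_lt_of_isometry (hK : ∀ g, ‖K g‖ = ‖g‖) {z : ℂ} {c : ℝ}
    (h : IsPseudoEigenvalue K z c) : ∃ w ∈ approxPointSpectrum K, dist z w < c := by
  by_cases hs : Function.Surjective K
  · exact exists_dist_lt_of_isStarNormal (isStarNormal_of_isometry_of_surjective hK hs) h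
  obtain ⟨g, hg⟩ := h
  have hlow : |1 - ‖z‖| < c := by
    have h1 : |1 - ‖z‖| * ‖g‖ < c * ‖g‖ := by
      refine lt_of_le_of_lt ?_ hg
      have := abs_norm_sub_norm_le (K g) (z • g)
      rwa [hK, norm_smul, ← one_sub_mul, abs_mul, abs_norm] at this
    exact lt_of_mul_lt_mul_right h1 (norm_nonneg _)
  obtain ⟨w, hw, hd⟩ : ∃ w : ℂ, ‖w‖ = 1 ∧ dist z w = |1 - ‖z‖| := by
    by_cases hz : z = 0
    · exact ⟨1, by simp, by simp [hz]⟩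
    · have hz' : ‖z‖ ≠ 0 := norm_ne_zero_iff.2 hz
      refine ⟨((‖z‖⁻¹ : ℝ) : ℂ) * z, ?_, ?_⟩
      · rw [norm_mul, Complex.norm_real, norm_inv, norm_norm, inv_mul_cancel₀ hz']
      · have : z - ((‖z‖⁻¹ : ℝ) : ℂ) * z = ((1 - ‖z‖⁻¹ : ℝ) : ℂ) * z := by push_cast; ring
        rw [dist_eq_norm, this, norm_mul, Complex.norm_real, Real.norm_eq_abs, ← abs_norm z,
          ← abs_mul, abs_norm, sub_mul, inv_mul_cancel₀ hz', one_mul, abs_sub_comm]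
  exact ⟨w, mem_approxPointSpectrum_of_not_surjective hK hs hw, by rwa [hd]⟩

end Isometries

/-! ### Finite information and search in the limit. -/

section Reads

variable {X : Type*}

/-- The value of `Γ` depends only on the measurements in `q`. -/
def ReadsOnly {M : Type*} (q : Finset (X × ℕ)) (Γ : (X → ℕ → X) → M) : Prop :=
  ∀ y y' : X → ℕ → X, (∀ a ∈ q, y a.1 a.2 = y' a.1 a.2) → Γ y = Γ y'

theorem ReadsOnly.isGeneralAlgorithm [MetricSpace X] {M : Type*} {q : Finset (X × ℕ)} {Γ : (X → ℕ → X) → M}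
    (h : ReadsOnly q Γ) (hq : q.Nonempty) (Ω : Set (X → X)) : IsGeneralAlgorithm Ω Γ :=
  ⟨fun _ => q, fun y _ => ⟨hq, fun y' _ hy => ⟨rfl, h y y' hy⟩⟩⟩

theorem ReadsOnly.comp {M N : Type*} {q : Finset (X × ℕ)} {Γ : (X → ℕ → X) → M}
    (h : ReadsOnly q Γ) (f : M → N) : ReadsOnly q fun y => f (Γ y) :=
  fun y y' hy => congrArg f (h y y' hy)

/-- Unbounded search in the limit: if the refutable conditions `R i` are decided by finitely many
measurements at each stage, then a witness of `∀ t, R i t y` can be found in one limit. -/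
theorem exists_limit_search {ι : Type*} [Countable ι] [Nonempty ι]
    (R : ι → ℕ → (X → ℕ → X) → Prop)
    (q : ℕ → Finset (X × ℕ)) (hR : ∀ i t, ReadsOnly (q t) (R i t)) :
    ∃ s : ℕ → (X → ℕ → X) → ι,
      (∀ n, ∃ p, q n ⊆ p ∧ ReadsOnly p (s n)) ∧
      ∀ y, (∃ i, ∀ t, R i t y) → ∃ i, (∀ t, R i t y) ∧ ∀ᶠ n in atTop, s n y = i := by
  classical
  obtain ⟨e, he⟩ := exists_surjective_nat ι
  -- Output the first candidate not refuted up to stage `n`: the finitely many before the first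
  -- valid one are eventually refuted. If none is left, `sInf ∅ = 0` gives a harmless default.
  refine ⟨fun n y => e (sInf {j | ∀ t ≤ n, R (e j) t y}), fun n =>
    ⟨(Finset.range (n + 1)).biUnion q, Finset.subset_biUnion_of_mem q (Finset.self_mem_range_succ n),
      fun y y' hy => ?_⟩, fun y hy => ?_⟩
  · have : {j | ∀ t ≤ n, R (e j) t y} = {j | ∀ t ≤ n, R (e j) t y'} := by
      ext j
      refine forall₂_congr fun t ht => (hR (e j) t y y' fun a ha => hy a ?_).to_iff
      exact Finset.mem_biUnion.2 ⟨t, Finset.mem_range.2 (Nat.lt_succ_of_le ht), ha⟩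
    simp only [this]
  · have hex : ∃ j, ∀ t, R (e j) t y := by
      obtain ⟨i, hi⟩ := hy
      obtain ⟨j, rfl⟩ := he i
      exact ⟨j, hi⟩
    refine ⟨e (Nat.find hex), Nat.find_spec hex, ?_⟩
    have hfalse : ∀ j ∈ Finset.range (Nat.find hex), ∀ᶠ n in atTop, ¬ ∀ t ≤ n, R (e j) t y := by
      intro j hj
      have := Nat.find_min hex (Finset.mem_range.1 hj)
      push Not at this
      obtain ⟨t, ht⟩ := this
      filter_upwards [eventually_ge_atTop t] with n hn hall
      exact ht (hall t hn)
    filter_upwards [(Finset.eventually_all _).2 hfalse] with n hn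
    have hmem : Nat.find hex ∈ {j | ∀ t ≤ n, R (e j) t y} := fun t _ => Nat.find_spec hex t
    refine congrArg e (le_antisymm (Nat.sInf_le hmem) (not_lt.1 fun hlt => ?_))
    exact hn _ (Finset.mem_range.2 hlt) (Nat.sInf_mem ⟨_, hmem⟩)

end Reads

/-- Pseudoeigenvalues are witnessed by elements of any dense family. -/
theorem IsPseudoEigenvalue.exists_of_denseRange {H ι : Type*} [NormedAddCommGroup H]
    [NormedSpace ℂ H] {K : H →L[ℂ] H} {e : ι → H} (he : DenseRange e) {z : ℂ} {c : ℝ}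
    (h : IsPseudoEigenvalue K z c) : ∃ i, ‖K (e i) - z • e i‖ < c * ‖e i‖ := by
  have hopen : IsOpen {g : H | ‖K g - z • g‖ < c * ‖g‖} :=
    isOpen_lt (by fun_prop) (by fun_prop)
  exact he.exists_mem_open hopen h

/-! ### Koopman operators on continuous functions. -/

section KoopmanNorms

section

variable {X : Type*} [MeasurableSpace X] {ω : Measure X} {F : X → X}

theorem norm_eq_sqrt_integral {f : Lp ℂ 2 ω} {u : X → ℂ} (h : f =ᵐ[ω] u) :
    ‖f‖ = √(∫ x, ‖u x‖ ^ 2 ∂ω) := by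
  have h1 : ‖f‖ ^ 2 = ∫ x, ‖u x‖ ^ 2 ∂ω := by
    rw [← RCLike.ofReal_inj (K := ℂ), RCLike.ofReal_pow, ← inner_self_eq_norm_sq_to_K, L2.inner_def,
      ← integral_ofReal]
    refine integral_congr_ae ?_
    filter_upwards [h] with x hx
    rw [hx, inner_self_eq_norm_sq_to_K, RCLike.ofReal_pow]
  rw [← h1, Real.sqrt_sq (norm_nonneg _)]

theorem norm_koopman_of_measurePreserving (hF : MeasurePreserving F ω ω) (g : Lp ℂ 2 ω) :
    ‖koopman F ω g‖ = ‖g‖ := by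
  have h : IsKoopman F ω (Lp.compMeasurePreservingₗᵢ ℂ F hF).toContinuousLinearMap :=
    fun g => Lp.coeFn_compMeasurePreserving g hF
  rw [← h.eq_koopman]
  exact (Lp.compMeasurePreservingₗᵢ ℂ F hF).norm_map g

end

variable {X : Type*} [MetricSpace X] [CompactSpace X] [MeasurableSpace X] [BorelSpace X]
  {ω : Measure X} [IsFiniteMeasure ω] {F : X → X}

theorem koopman_toLp_ae (hF : Measure.QuasiMeasurePreserving F ω ω) (hb : KoopmanBounded F ω)
    (g : C(X, ℂ)) :
    (koopman F ω (ContinuousMap.toLp 2 ω ℂ g) : X → ℂ) =ᵐ[ω] fun x => g (F x) :=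
  (koopman_spec hb _).trans (hF.ae_eq_comp (ContinuousMap.coeFn_toLp ω g))

theorem koopman_sub_smul_toLp_ae (hF : Measure.QuasiMeasurePreserving F ω ω)
    (hb : KoopmanBounded F ω) (g : C(X, ℂ)) (z : ℂ) :
    (koopman F ω (ContinuousMap.toLp 2 ω ℂ g) - z • ContinuousMap.toLp 2 ω ℂ g :
      Lp ℂ 2 ω) =ᵐ[ω] fun x => g (F x) - z * g x := by
  filter_upwards [koopman_toLp_ae hF hb g, ContinuousMap.coeFn_toLp (p := 2) (𝕜 := ℂ) ω g,
    Lp.coeFn_sub (koopman F ω (ContinuousMap.toLp 2 ω ℂ g)) (z • ContinuousMap.toLp 2 ω ℂ g),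
    Lp.coeFn_smul z (ContinuousMap.toLp 2 ω ℂ g)] with x h1 h2 h3 h4
  rw [h3, Pi.sub_apply, h4, Pi.smul_apply, h1, h2, smul_eq_mul]

theorem toLp_one_ne_zero (hω : ω ≠ 0) : ContinuousMap.toLp 2 ω ℂ (1 : C(X, ℂ)) ≠ 0 := by
  intro h0
  have h1 := ContinuousMap.coeFn_toLp (p := 2) (𝕜 := ℂ) ω (1 : C(X, ℂ))
  rw [h0] at h1
  have h2 : ∀ᵐ x ∂ω, False := by
    filter_upwards [h1, Lp.coeFn_zero ℂ 2 ω] with x h3 h4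
    rw [h4] at h3
    simp at h3
  rw [Filter.eventually_false_iff_eq_bot, ae_eq_bot] at h2
  exact hω h2

/-- Constants are fixed. Hence `1` can be added to every output to keep it nonempty, without
introducing error. -/
theorem one_mem_approxPointSpectrum (hω : ω ≠ 0) (hF : Measure.QuasiMeasurePreserving F ω ω)
    (hb : KoopmanBounded F ω) : (1 : ℂ) ∈ approxPointSpectrum (koopman F ω) := by
  refine mem_approxPointSpectrum_iff.2 fun c hc => ⟨ContinuousMap.toLp 2 ω ℂ (1 : C(X, ℂ)), ?_⟩
  rw [norm_eq_sqrt_integral (koopman_sub_smul_toLp_ae hF hb 1 1)]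
  simpa using mul_pos hc (norm_pos_iff.2 (toLp_one_ne_zero hω))

/-- By density the witness may be a continuous `g`. Uniform continuity makes `g ∘ F'` uniformly
close to `g ∘ F`, within the slack `η` of the strict inequality; no bound on the norm of the
perturbed operator is needed. -/
theorem isPseudoEigenvalue_of_uniformly_close {z : ℂ} {c : ℝ}
    (hF : Measure.QuasiMeasurePreserving F ω ω) (hb : KoopmanBounded F ω)
    (h : IsPseudoEigenvalue (koopman F ω) z c) :
    ∃ δ > 0, ∀ F', Measure.QuasiMeasurePreserving F' ω ω → KoopmanBounded F' ω →
      (∀ x, dist (F' x) (F x) < δ) → IsPseudoEigenvalue (koopman F' ω) z c := by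
  obtain ⟨g, hg⟩ := h.exists_of_denseRange
    (ContinuousMap.toLp_denseRange (p := 2) ℂ ω ℂ ENNReal.ofNat_ne_top)
  set f := ContinuousMap.toLp 2 ω ℂ g
  set η := c * ‖f‖ - ‖koopman F ω f - z • f‖ with hη
  have hηpos : 0 < η := sub_pos.2 hg
  set m := ω.real Set.univ ^ (ENNReal.toReal 2)⁻¹ with hm
  have hm0 : 0 ≤ m := by positivity
  obtain ⟨δ, hδ, hunif⟩ := Metric.uniformContinuous_iff.1
    (CompactSpace.uniformContinuous_of_continuous g.continuous) (η / (m + 1)) (by positivity)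
  refine ⟨δ, hδ, fun F' hF' hb' hclose => ⟨f, ?_⟩⟩
  have hdiff : ‖koopman F' ω f - koopman F ω f‖ ≤ m * (η / (m + 1)) := by
    refine Lp.norm_le_of_ae_bound (by positivity) ?_
    filter_upwards [koopman_toLp_ae hF hb g, koopman_toLp_ae hF' hb' g,
      Lp.coeFn_sub (koopman F' ω f) (koopman F ω f)] with x h1 h2 h3
    rw [h3, Pi.sub_apply, h1, h2, ← dist_eq_norm]
    exact (hunif (hclose x)).le
  have hlt : m * (η / (m + 1)) < η := by
    rw [← mul_div_assoc, div_lt_iff₀ (by positivity)]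
    nlinarith
  calc ‖koopman F' ω f - z • f‖
      = ‖(koopman F' ω f - koopman F ω f) + (koopman F ω f - z • f)‖ := by
        rw [sub_add_sub_cancel]
    _ ≤ ‖koopman F' ω f - koopman F ω f‖ + ‖koopman F ω f - z • f‖ := norm_add_le _ _
    _ < c * ‖f‖ := by linarith

/-- A countable family of continuous functions, nonzero in `L²`, that witnesses all
pseudoeigenvalues. -/
theorem exists_witness_family (hω : ω ≠ 0) : ∃ g : ℕ → C(X, ℂ), ∀ (K : Lp ℂ 2 ω →L[ℂ] Lp ℂ 2 ω)
    (z : ℂ) (c : ℝ), IsPseudoEigenvalue K z c ↔ ∃ l,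
      ‖K (ContinuousMap.toLp 2 ω ℂ (g l)) - z • ContinuousMap.toLp 2 ω ℂ (g l)‖ /
        ‖ContinuousMap.toLp 2 ω ℂ (g l)‖ < c := by
  classical
  let T : C(X, ℂ) → Lp ℂ 2 ω := ContinuousMap.toLp 2 ω ℂ
  have hd : DenseRange fun l => T (denseSeq C(X, ℂ) l) :=
    (ContinuousMap.toLp_denseRange (p := 2) ℂ ω ℂ ENNReal.ofNat_ne_top).comp
      (denseRange_denseSeq _) (ContinuousMap.toLp 2 ω ℂ).continuous
  -- Zero vectors are replaced by `1`: their quotient `0 / 0 = 0` would count as a false witness.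
  refine ⟨fun l => if T (denseSeq C(X, ℂ) l) = 0 then 1 else denseSeq C(X, ℂ) l,
    fun K z c => ⟨fun h => ?_, ?_⟩⟩
  · obtain ⟨l, hl⟩ := h.exists_of_denseRange hd
    have h0 : T (denseSeq C(X, ℂ) l) ≠ 0 := by
      intro h0
      simp [h0] at hl
    refine ⟨l, ?_⟩
    beta_reduce
    rw [if_neg h0, div_lt_iff₀ (norm_pos_iff.2 h0)]
    exact hl
  · rintro ⟨l, hl⟩
    refine ⟨_, (div_lt_iff₀ (norm_pos_iff.2 ?_)).1 hl⟩
    beta_reduce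
    split_ifs with h0
    · exact toLp_one_ne_zero hω
    · exact h0

end KoopmanNorms

/-! ### Residuals computed from measurements. -/

section Quadrature

variable {X : Type*} [MetricSpace X] [CompactSpace X] [MeasurableSpace X] [BorelSpace X]
  [Nonempty X]

/-- A simple function approximating the identity of `X`. -/
noncomputable def node (X : Type*) [MetricSpace X] [CompactSpace X] [MeasurableSpace X]
    [BorelSpace X] [Nonempty X] (t : ℕ) : SimpleFunc X X :=
  SimpleFunc.nearestPt (denseSeq X) t

theorem tendsto_node (x : X) : Tendsto (fun t => node X t x) atTop (𝓝 x) :=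
  SimpleFunc.tendsto_nearestPt (denseRange_denseSeq X x)

/-- The measurements taken at the nodes of level `t`. -/
noncomputable def nodeReads (X : Type*) [MetricSpace X] [CompactSpace X] [MeasurableSpace X]
    [BorelSpace X] [Nonempty X] (t : ℕ) : Finset (X × ℕ) :=
  (node X t).range ×ˢ {t}

theorem nodeReads_nonempty (t : ℕ) : (nodeReads X t).Nonempty :=
  ⟨(node X t (Classical.arbitrary X), t),
    Finset.mk_mem_product (SimpleFunc.mem_range_self _ _) (Finset.mem_singleton_self t)⟩

/-- The quotient `‖(K - z) g‖ / ‖g‖` in `L²`, computed by quadrature from the measurements taken at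
the nodes of level `t`. -/
noncomputable def quadResidual (ω : Measure X) (g : C(X, ℂ)) (z : ℂ) (t : ℕ)
    (y : X → ℕ → X) : ℝ :=
  √(∫ x, ‖g (y (node X t x) t) - z * g x‖ ^ 2 ∂ω) / √(∫ x, ‖g x‖ ^ 2 ∂ω)

theorem quadResidual_readsOnly (ω : Measure X) (g : C(X, ℂ)) (z : ℂ) (t : ℕ) :
    ReadsOnly (nodeReads X t) (quadResidual ω g z t) := by
  intro y y' hy
  have h : ∀ x, y (node X t x) t = y' (node X t x) t := fun x =>
    hy (node X t x, t)
      (Finset.mk_mem_product (SimpleFunc.mem_range_self _ x) (Finset.mem_singleton_self t))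
  simp only [quadResidual, h]

variable {ω : Measure X} [IsFiniteMeasure ω] {F : X → X}

/-- Dominated convergence: nodes tend to `x`, `F` is continuous and the measurement error `2⁻ᵗ`
vanishes, while the integrands are bounded through `‖g‖`. -/
theorem tendsto_quadResidual (hF : F ∈ ContinuousClass ω) {y : X → ℕ → X}
    (hy : IsSnapshotData F y) (g : C(X, ℂ)) (z : ℂ) :
    Tendsto (fun t => quadResidual ω g z t y) atTop
      (𝓝 (‖koopman F ω (ContinuousMap.toLp 2 ω ℂ g) - z • ContinuousMap.toLp 2 ω ℂ g‖ /
        ‖ContinuousMap.toLp 2 ω ℂ g‖)) := by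
  obtain ⟨hc, hq, hb⟩ := hF
  rw [norm_eq_sqrt_integral (koopman_sub_smul_toLp_ae hq hb g z),
    norm_eq_sqrt_integral (ContinuousMap.coeFn_toLp (p := 2) (𝕜 := ℂ) ω g)]
  refine Tendsto.div_const (Tendsto.sqrt ?_) _
  refine tendsto_integral_of_dominated_convergence (fun _ => (‖g‖ + ‖z‖ * ‖g‖) ^ 2)
    (fun t => ?_) (integrable_const _) (fun t => ?_) ?_
  · have h1 : Measurable fun x => y (node X t x) t :=
      ((node X t).map fun x => y x t).measurable
    have h2 : Measurable fun x => ‖g (y (node X t x) t) - z * g x‖ ^ 2 :=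
      (((g.continuous.measurable.comp h1).sub
        (g.continuous.measurable.const_mul z)).norm).pow_const 2
    exact h2.aestronglyMeasurable
  · refine Eventually.of_forall fun x => ?_
    rw [Real.norm_of_nonneg (by positivity)]
    gcongr
    refine (norm_sub_le _ _).trans ?_
    rw [norm_mul]
    gcongr <;> exact g.norm_coe_le_norm _
  · refine Eventually.of_forall fun x => ?_
    have h1 : Tendsto (fun t => y (node X t x) t) atTop (𝓝 (F x)) := by
      have h2 : Tendsto (fun t => F (node X t x)) atTop (𝓝 (F x)) :=
        (hc.tendsto x).comp (tendsto_node x)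
      refine h2.congr_dist ?_
      exact squeeze_zero (fun _ => dist_nonneg) (fun t => hy _ t)
        (tendsto_pow_atTop_nhds_zero_of_lt_one (by norm_num) (by norm_num))
    exact ((((g.continuous.tendsto _).comp h1).sub_const _).norm).pow 2

end Quadrature

/-! ### Grid approximation of the spectrum from above. -/

section Grid

/-- The point of the square grid of mesh `2⁻ⁿ` with index `p`. -/
noncomputable def gridPoint (n : ℕ) (p : ℤ × ℤ) : ℂ :=
  ⟨p.1 * (1 / 2) ^ n, p.2 * (1 / 2) ^ n⟩

/-- The indices with entries of absolute value at most `n`. -/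
noncomputable def box (n : ℕ) : Finset (ℤ × ℤ) :=
  Finset.Icc (-(n : ℤ)) n ×ˢ Finset.Icc (-(n : ℤ)) n

theorem exists_dist_gridPoint_le (n : ℕ) (z : ℂ) : ∃ p, dist z (gridPoint n p) ≤ (1 / 2) ^ n := by
  have key : ∀ x : ℝ, |x - round (x * 2 ^ n) * (1 / 2) ^ n| ≤ (1 / 2) ^ n / 2 := by
    intro x
    have h1 := abs_sub_round (x * 2 ^ n)
    have h2 : x - round (x * 2 ^ n) * (1 / 2) ^ n =
        (x * 2 ^ n - round (x * 2 ^ n)) * (1 / 2) ^ n := by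
      rw [sub_mul, mul_assoc, ← mul_pow]
      norm_num
    rw [h2, abs_mul, abs_of_pos (by positivity : (0 : ℝ) < (1 / 2) ^ n)]
    exact (mul_le_mul_of_nonneg_right h1 (by positivity)).trans_eq (by ring)
  refine ⟨(round (z.re * 2 ^ n), round (z.im * 2 ^ n)), ?_⟩
  rw [dist_eq_norm]
  refine (Complex.norm_le_abs_re_add_abs_im _).trans ?_
  have hre := key z.re
  have him := key z.im
  simp only [gridPoint, Complex.sub_re, Complex.sub_im]
  linarith

theorem eventually_mem_box (p : ℤ × ℤ) : ∀ᶠ n in atTop, p ∈ box n := by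
  filter_upwards [eventually_ge_atTop (max p.1.natAbs p.2.natAbs)] with n hn
  simp only [box, Finset.mem_product, Finset.mem_Icc]
  omega

theorem finite_norm_gridPoint_le (m : ℕ) (R : ℝ) : {p | ‖gridPoint m p‖ ≤ R}.Finite := by
  obtain ⟨n, hn⟩ := exists_nat_ge (R * 2 ^ m)
  refine (box n).finite_toSet.subset fun p hp => ?_
  have key : ∀ a : ℤ, |(a : ℝ) * (1 / 2) ^ m| ≤ R → -(n : ℤ) ≤ a ∧ a ≤ n := by
    intro a ha
    rw [abs_mul, abs_of_pos (by positivity : (0 : ℝ) < (1 / 2) ^ m), one_div, inv_pow,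
      ← div_eq_mul_inv, div_le_iff₀ (by positivity)] at ha
    have h1 : |(a : ℝ)| ≤ n := ha.trans hn
    rw [← abs_le]
    exact_mod_cast h1
  have hp' : ‖gridPoint m p‖ ≤ R := hp
  have hre := key p.1 ((Complex.abs_re_le_norm (gridPoint m p)).trans hp')
  have him := key p.2 ((Complex.abs_im_le_norm (gridPoint m p)).trans hp')
  exact Finset.mem_product.2 ⟨Finset.mem_Icc.2 hre, Finset.mem_Icc.2 him⟩

/-- A finite set of complex numbers, together with `1`, as a nonempty compact set. -/
def finiteWithOne (s : Finset ℂ) : NonemptyCompacts ℂ where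
  carrier := insert 1 (s : Set ℂ)
  isCompact' := (s.finite_toSet.insert 1).isCompact
  nonempty' := Set.insert_nonempty _ _

theorem mem_finiteWithOne {s : Finset ℂ} {z : ℂ} : z ∈ finiteWithOne s ↔ z = 1 ∨ z ∈ s :=
  Iff.rfl

/-- The indexed points of the grid of mesh `2⁻⁽ᵐ⁺¹⁾`, together with `1`. -/
noncomputable def gridSet (m : ℕ) (I : Finset (ℤ × ℤ)) : NonemptyCompacts ℂ :=
  finiteWithOne (I.image (gridPoint (m + 1)))

theorem eventually_eq_of_forall_mem {ι : Type*} {I : Finset ι} {A : ℕ → Finset ι}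
    (h₁ : ∀ n, A n ⊆ I) (h₂ : ∀ p ∈ I, ∀ᶠ n in atTop, p ∈ A n) : ∀ᶠ n in atTop, A n = I := by
  filter_upwards [(Finset.eventually_all I).2 h₂] with n hn
  exact (h₁ n).antisymm hn

variable {H : Type*} [NormedAddCommGroup H] [NormedSpace ℂ H] {K : H →L[ℂ] H}

theorem finite_pseudoEigenvalue_gridPoint (K : H →L[ℂ] H) (m : ℕ) (c : ℝ) :
    {p | IsPseudoEigenvalue K (gridPoint m p) c}.Finite :=
  (finite_norm_gridPoint_le m (‖K‖ + c)).subset fun _ hp =>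
    (IsPseudoEigenvalue.norm_lt (z := gridPoint m _) hp).le

/-- Indices of the pseudoeigenvalues at level `2⁻ᵐ` in the grid of mesh `2⁻⁽ᵐ⁺¹⁾`. -/
noncomputable def pseudoIndices (K : H →L[ℂ] H) (m : ℕ) : Finset (ℤ × ℤ) :=
  (finite_pseudoEigenvalue_gridPoint K (m + 1) ((1 / 2) ^ m)).toFinset

theorem mem_pseudoIndices {m : ℕ} {p : ℤ × ℤ} :
    p ∈ pseudoIndices K m ↔ IsPseudoEigenvalue K (gridPoint (m + 1) p) ((1 / 2) ^ m) := by
  simp [pseudoIndices]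

/-- The mesh is half the threshold, which yields the strict inequality that pseudoeigenvalues
require. -/
theorem exists_mem_gridSet_dist_le {z : ℂ} (hz : z ∈ approxPointSpectrum K) (m : ℕ) :
    ∃ x ∈ gridSet m (pseudoIndices K m), dist z x ≤ (1 / 2) ^ m := by
  obtain ⟨p, hp⟩ := exists_dist_gridPoint_le (m + 1) z
  have hlt : dist z (gridPoint (m + 1) p) < (1 / 2) ^ m :=
    hp.trans_lt (pow_lt_pow_right_of_lt_one₀ (by norm_num) (by norm_num) (Nat.lt_succ_self m))
  refine ⟨gridPoint (m + 1) p, mem_finiteWithOne.2 (Or.inr (Finset.mem_image_of_mem _ ?_)), hlt.le⟩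
  exact mem_pseudoIndices.2 (isPseudoEigenvalue_of_dist_lt hz hlt)

theorem subset_gridSet_add_closedBall (m : ℕ) :
    approxPointSpectrum K ⊆ (gridSet m (pseudoIndices K m) : Set ℂ) +
      Metric.closedBall (0 : ℂ) ((1 / 2 : ℝ) ^ m) := by
  intro z hz
  obtain ⟨x, hx, hd⟩ := exists_mem_gridSet_dist_le hz m
  refine Set.mem_add.2 ⟨x, hx, z - x, ?_, add_sub_cancel _ _⟩
  rwa [mem_closedBall_zero_iff, ← dist_eq_norm]

theorem tendsto_gridSet {S : NonemptyCompacts ℂ} (hS : (S : Set ℂ) = approxPointSpectrum K)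
    (h1 : (1 : ℂ) ∈ approxPointSpectrum K) :
    Tendsto (fun m => gridSet m (pseudoIndices K m)) atTop (𝓝 S) := by
  have hmem : ∀ z, z ∈ S ↔ z ∈ approxPointSpectrum K := fun z => by
    rw [← hS, SetLike.mem_coe]
  have hpow : ∀ ε > (0 : ℝ), ∀ᶠ m : ℕ in atTop, (1 / 2 : ℝ) ^ m < ε := fun ε hε =>
    (tendsto_pow_atTop_nhds_zero_of_lt_one (by norm_num) (by norm_num)).eventually (gt_mem_nhds hε)
  refine tendsto_nonemptyCompacts_of_dist (fun ε hε => ?_) fun z hz ε hε => ?_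
  · obtain ⟨δ, hδ, hclose⟩ := exists_pseudoEigenvalue_close K hε
    filter_upwards [hpow δ hδ] with m hm x hx
    rcases mem_finiteWithOne.1 hx with rfl | hx
    · exact ⟨1, (hmem 1).2 h1, by simpa using hε.le⟩
    · obtain ⟨p, hp, rfl⟩ := Finset.mem_image.1 hx
      obtain ⟨w, hw, hd⟩ := hclose _ ((mem_pseudoIndices.1 hp).mono hm.le)
      exact ⟨w, (hmem w).2 hw, hd.le⟩
  · filter_upwards [hpow ε hε] with m hm
    obtain ⟨x, hx, hd⟩ := exists_mem_gridSet_dist_le ((hmem z).1 hz) m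
    exact ⟨x, hx, hd.trans hm.le⟩

end Grid

section Spectrum

variable {X : Type*} [MetricSpace X] [CompactSpace X] [MeasurableSpace X] [BorelSpace X]
  {ω : Measure X} [IsFiniteMeasure ω]

/-- The approximate point spectrum of a Koopman operator as a nonempty compact set. -/
noncomputable def spectralSet (hω : ω ≠ 0) {F : X → X} (hF : Measure.QuasiMeasurePreserving F ω ω)
    (hb : KoopmanBounded F ω) : NonemptyCompacts ℂ where
  carrier := approxPointSpectrum (koopman F ω)
  isCompact' := isCompact_approxPointSpectrum _
  nonempty' := ⟨1, one_mem_approxPointSpectrum hω hF hb⟩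

theorem mem_spectralSet (hω : ω ≠ 0) {F : X → X} (hF : Measure.QuasiMeasurePreserving F ω ω)
    (hb : KoopmanBounded F ω) {z : ℂ} :
    z ∈ spectralSet hω hF hb ↔ z ∈ approxPointSpectrum (koopman F ω) :=
  Iff.rfl

end Spectrum

/-! ### Two limits with a known modulus of continuity. -/

section ModulusOfContinuity

variable {X : Type*} [MetricSpace X]

/-- The maps in `Ω` that could have produced the measurements `y` of precision `2⁻ⁿ` at the
points in `N`. -/
def consistentMaps (Ω : Set (X → X)) (N : Finset X) (n : ℕ) (y : X → ℕ → X) : Set (X → X) :=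
  {F | F ∈ Ω ∧ ∀ a ∈ N, dist (F a) (y a n) ≤ (1 / 2 : ℝ) ^ n}

theorem consistentMaps_congr {Ω : Set (X → X)} {N : Finset X} {n : ℕ} {y y' : X → ℕ → X}
    (h : ∀ a ∈ N, y a n = y' a n) : consistentMaps Ω N n y = consistentMaps Ω N n y' := by
  ext F
  refine and_congr_right fun _ => forall₂_congr fun a ha => ?_
  rw [h a ha]

theorem exists_nets (X : Type*) [MetricSpace X] [CompactSpace X] :
    ∃ N : ℕ → Finset X, ∀ n x, ∃ a ∈ N n, dist x a < (1 / 2 : ℝ) ^ n := by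
  have h : ∀ n : ℕ, ∃ N : Finset X, ∀ x, ∃ a ∈ N, dist x a < (1 / 2 : ℝ) ^ n := by
    intro n
    obtain ⟨t, -, htf, hcov⟩ := (isCompact_univ (X := X)).finite_cover_balls
      (e := (1 / 2 : ℝ) ^ n) (by positivity)
    refine ⟨htf.toFinset, fun x => ?_⟩
    obtain ⟨a, ha, hxa⟩ := Set.mem_iUnion₂.1 (hcov (Set.mem_univ x))
    exact ⟨a, htf.mem_toFinset.2 ha, hxa⟩
  exact ⟨fun n => (h n).choose, fun n => (h n).choose_spec⟩

variable [MeasurableSpace X]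

/-- Passing from `x` to a net point costs `α (2⁻ⁿ)` for each of the two maps, and their values there
differ by at most two measurement errors. -/
theorem eventually_consistentMaps_close {ω : Measure X} {α : ℝ≥0 → ℝ≥0} (hα : Monotone α)
    (hαc : Continuous α) (hα0 : α 0 = 0) {N : ℕ → Finset X}
    (hN : ∀ n x, ∃ a ∈ N n, dist x a < (1 / 2 : ℝ) ^ n) {F : X → X} (hF : F ∈ ModulusClass ω α)
    {y : X → ℕ → X} (hy : IsSnapshotData F y) {δ : ℝ} (hδ : 0 < δ) :
    ∀ᶠ n in atTop, ∀ F' ∈ consistentMaps (ModulusClass ω α) (N n) n y,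
      ∀ x, dist (F' x) (F x) < δ := by
  have hlim : Tendsto (fun n : ℕ => 2 * ((α ((1 / 2) ^ n) : ℝ≥0) : ℝ) + 2 * (1 / 2 : ℝ) ^ n) atTop
      (𝓝 (2 * 0 + 2 * 0)) := by
    refine Tendsto.add (Tendsto.const_mul _ ?_) (Tendsto.const_mul _
      (tendsto_pow_atTop_nhds_zero_of_lt_one (by norm_num) (by norm_num)))
    have h1 : Tendsto (fun n : ℕ => (1 / 2 : ℝ≥0) ^ n) atTop (𝓝 0) :=
      NNReal.tendsto_pow_atTop_nhds_zero_of_lt_one (by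
        rw [← NNReal.coe_lt_coe]; norm_num)
    have h2 := (hαc.tendsto 0).comp h1
    rw [hα0] at h2
    exact NNReal.tendsto_coe.2 h2
  rw [mul_zero, add_zero] at hlim
  filter_upwards [hlim.eventually (gt_mem_nhds hδ)] with n hn F' hF' x
  obtain ⟨a, ha, hxa⟩ := hN n x
  have hmod : ∀ E ∈ ModulusClass ω α, dist (E x) (E a) ≤ α ((1 / 2) ^ n) := by
    intro E hE
    rw [← coe_nndist, NNReal.coe_le_coe]
    refine (hE.1 x a).trans (hα ?_)
    rw [← NNReal.coe_le_coe, coe_nndist]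
    simpa using hxa.le
  have h1 := hmod F' hF'.1
  have h2 := hmod F hF
  have h3 := hF'.2 a ha
  have h4 := hy a n
  have h5 := dist_triangle4 (F' x) (F' a) (F a) (F x)
  have h6 := dist_triangle_right (F' a) (F a) (y a n)
  rw [dist_comm (F a) (F x)] at h5
  linarith

theorem exists_algorithms_modulusClass [CompactSpace X] [BorelSpace X] (ω : Measure X) [IsFiniteMeasure ω] (hω : ω ≠ 0)
    (α : ℝ≥0 → ℝ≥0) (hα : Monotone α) (hαc : Continuous α) (hα0 : α 0 = 0) :
    ∃ Γ : ℕ → ℕ → (X → ℕ → X) → NonemptyCompacts ℂ,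
      (∀ n₂ n₁, IsGeneralAlgorithm (ModulusClass ω α) (Γ n₂ n₁)) ∧
      ∀ F ∈ ModulusClass ω α, ∀ y, IsSnapshotData F y →
        ∃ (S : NonemptyCompacts ℂ) (G : ℕ → NonemptyCompacts ℂ),
          (S : Set ℂ) = approxPointSpectrum (koopman F ω) ∧
          (∀ n₂, Tendsto (fun n₁ => Γ n₂ n₁ y) atTop (𝓝 (G n₂))) ∧
          Tendsto G atTop (𝓝 S) ∧
          ∀ n₂, (S : Set ℂ) ⊆ (G n₂ : Set ℂ) + Metric.closedBall (0 : ℂ) ((1 / 2 : ℝ) ^ n₂) := by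
  classical
  have : NeZero ω := ⟨hω⟩
  have : Nonempty X := Measure.nonempty_of_neZero ω
  obtain ⟨N, hN⟩ := exists_nets X
  -- A general algorithm may quantify over all consistent maps; only its reads must be finite.
  let A : ℕ → ℕ → (X → ℕ → X) → Finset (ℤ × ℤ) := fun m n y =>
    (box n).filter fun p => ∀ F ∈ consistentMaps (ModulusClass ω α) (N n) n y,
      IsPseudoEigenvalue (koopman F ω) (gridPoint (m + 1) p) ((1 / 2) ^ m)
  refine ⟨fun m n y => gridSet m (A m n y), fun m n => ?_, fun F hF y hy => ?_⟩
  · have hreads : ReadsOnly (N n ×ˢ {n}) (A m n) := by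
      intro y y' h
      have : consistentMaps (ModulusClass ω α) (N n) n y =
          consistentMaps (ModulusClass ω α) (N n) n y' := consistentMaps_congr fun a ha =>
        h (a, n) (Finset.mk_mem_product ha (Finset.mem_singleton_self n))
      simp only [A, this]
    refine (hreads.comp (gridSet m)).isGeneralAlgorithm ?_ _
    obtain ⟨a, ha, -⟩ := hN n (Classical.arbitrary X)
    exact ⟨(a, n), Finset.mk_mem_product ha (Finset.mem_singleton_self n)⟩
  · have hq := hF.2.1
    have hb := hF.2.2
    refine ⟨spectralSet hω hq hb, fun m => gridSet m (pseudoIndices (koopman F ω) m), rfl,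
      fun m => ?_, tendsto_gridSet rfl (one_mem_approxPointSpectrum hω hq hb),
      fun m => subset_gridSet_add_closedBall m⟩
    have hev : ∀ᶠ n in atTop, A m n y = pseudoIndices (koopman F ω) m := by
      refine eventually_eq_of_forall_mem (fun n p hp => ?_) fun p hp => ?_
      · exact mem_pseudoIndices.2 ((Finset.mem_filter.1 hp).2 F ⟨hF, fun a _ => hy a n⟩)
      · obtain ⟨δ, hδ, hclose⟩ := isPseudoEigenvalue_of_uniformly_close hq hb
          (mem_pseudoIndices.1 hp)
        filter_upwards [eventually_mem_box p,
          eventually_consistentMaps_close hα hαc hα0 hN hF hy hδ] with n hn₁ hn₂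
        exact Finset.mem_filter.2 ⟨hn₁, fun F' hF' =>
          hclose F' hF'.1.2.1 hF'.1.2.2 (hn₂ F' hF')⟩
    exact tendsto_const_nhds.congr' (hev.mono fun n hn => by simp only [hn])

end ModulusOfContinuity

/-! ### Algorithms by quadrature and search. -/

section Quadrature

variable {X : Type*} [MetricSpace X] [CompactSpace X] [MeasurableSpace X] [BorelSpace X]

/-- The test `ρ < 2⁻ᵐ` is replaced by two overlapping ones. The overlap guarantees a valid witness;
any valid witness contains only true pseudoeigenvalues and, in its box, misses only residuals within
`2 / (n + 1)` of the threshold or above it. -/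
theorem exists_algorithms_continuousClass (ω : Measure X) [IsFiniteMeasure ω] (hω : ω ≠ 0) :
    ∃ Γ : ℕ → ℕ → ℕ → (X → ℕ → X) → NonemptyCompacts ℂ,
      (∀ n₃ n₂ n₁, IsGeneralAlgorithm (ContinuousClass ω) (Γ n₃ n₂ n₁)) ∧
      ∀ F ∈ ContinuousClass ω, ∀ y, IsSnapshotData F y →
        ∃ (S : NonemptyCompacts ℂ) (G : ℕ → NonemptyCompacts ℂ) (G' : ℕ → ℕ → NonemptyCompacts ℂ),
          (S : Set ℂ) = approxPointSpectrum (koopman F ω) ∧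
          (∀ n₃ n₂, Tendsto (fun n₁ => Γ n₃ n₂ n₁ y) atTop (𝓝 (G' n₃ n₂))) ∧
          (∀ n₃, Tendsto (fun n₂ => G' n₃ n₂) atTop (𝓝 (G n₃))) ∧
          Tendsto G atTop (𝓝 S) ∧
          ∀ n₃, (S : Set ℂ) ⊆ (G n₃ : Set ℂ) + Metric.closedBall (0 : ℂ) ((1 / 2 : ℝ) ^ n₃) := by
  classical
  have : NeZero ω := ⟨hω⟩
  have : Nonempty X := Measure.nonempty_of_neZero ω
  obtain ⟨g, hg⟩ := exists_witness_family hω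
  let D : ℕ → Finset ((ℤ × ℤ) × ℕ) := fun n => box n ×ˢ Finset.range (n + 1)
  let r : ℕ → (ℤ × ℤ) × ℕ → ℕ → (X → ℕ → X) → ℝ := fun m q t y =>
    quadResidual ω (g q.2) (gridPoint (m + 1) q.1) t y
  -- a witness `(A, N)` separates, from stage `N` on, the small residuals from the large ones
  let R : ℕ → ℕ → Finset ((ℤ × ℤ) × ℕ) × ℕ → ℕ → (X → ℕ → X) → Prop := fun m n i t y =>
    i.1 ⊆ D n ∧ (i.2 ≤ t → ∀ q ∈ D n,
      (q ∈ i.1 → r m q t y ≤ (1 / 2) ^ m - 1 / ((n : ℝ) + 1)) ∧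
      (q ∉ i.1 → (1 / 2) ^ m - 2 / ((n : ℝ) + 1) ≤ r m q t y))
  have hR : ∀ m n i t, ReadsOnly (nodeReads X t) (R m n i t) := by
    intro m n i t y y' h
    have hr : ∀ q, r m q t y = r m q t y' := fun q =>
      quadResidual_readsOnly ω (g q.2) (gridPoint (m + 1) q.1) t y y' h
    simp only [R, hr]
  choose s hsread hs using fun m n => exists_limit_search (R m n) (nodeReads X) (hR m n)
  refine ⟨fun m n k y => gridSet m ((s m n k y).1.image Prod.fst), fun m n k => ?_,
    fun F hF y hy => ?_⟩
  · obtain ⟨p, hp, hread⟩ := hsread m n k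
    exact (hread.comp fun i => gridSet m (i.1.image Prod.fst)).isGeneralAlgorithm
      ((nodeReads_nonempty k).mono hp) _
  have hq := hF.2.1
  have hb := hF.2.2
  let ρ : ℕ → (ℤ × ℤ) × ℕ → ℝ := fun m q =>
    ‖koopman F ω (ContinuousMap.toLp 2 ω ℂ (g q.2)) -
      gridPoint (m + 1) q.1 • ContinuousMap.toLp 2 ω ℂ (g q.2)‖ /
        ‖ContinuousMap.toLp 2 ω ℂ (g q.2)‖
  have hρ : ∀ m q, Tendsto (fun t => r m q t y) atTop (𝓝 (ρ m q)) := fun m q =>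
    tendsto_quadResidual hF hy (g q.2) (gridPoint (m + 1) q.1)
  have hpos : ∀ n : ℕ, 0 < 1 / ((n : ℝ) + 1) := fun n => Nat.one_div_pos_of_nat
  have hex : ∀ m n, ∃ i, ∀ t, R m n i t y := by
    intro m n
    -- With this cut both alternatives hold strictly, with room to spare, for the limits `ρ`, hence
    -- eventually for the quadratures.
    let A := (D n).filter fun q => ρ m q < (1 / 2) ^ m - 1 / ((n : ℝ) + 1)
    have hev : ∀ᶠ t in atTop, ∀ q ∈ D n,
        (q ∈ A → r m q t y ≤ (1 / 2) ^ m - 1 / ((n : ℝ) + 1)) ∧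
        (q ∉ A → (1 / 2) ^ m - 2 / ((n : ℝ) + 1) ≤ r m q t y) := by
      refine (Finset.eventually_all _).2 fun q hqD => ?_
      by_cases hqA : ρ m q < (1 / 2) ^ m - 1 / ((n : ℝ) + 1)
      · filter_upwards [(hρ m q).eventually (gt_mem_nhds hqA)] with t ht
        exact ⟨fun _ => ht.le, fun h => absurd (Finset.mem_filter.2 ⟨hqD, hqA⟩) h⟩
      · have hlt : (1 / 2) ^ m - 2 / ((n : ℝ) + 1) < ρ m q := by
          have h2 : 2 / ((n : ℝ) + 1) = 1 / ((n : ℝ) + 1) + 1 / ((n : ℝ) + 1) := by ring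
          linarith [hpos n]
        filter_upwards [(hρ m q).eventually (lt_mem_nhds hlt)] with t ht
        exact ⟨fun h => absurd (Finset.mem_filter.1 h).2 hqA, fun _ => ht.le⟩
    obtain ⟨N, hN⟩ := eventually_atTop.1 hev
    exact ⟨(A, N), fun t => ⟨Finset.filter_subset _ _, fun ht => hN t ht⟩⟩
  choose i hi hlim using fun m n => hs m n y (hex m n)
  have hin : ∀ m n q, q ∈ (i m n).1 → ρ m q < (1 / 2) ^ m := by
    intro m n q hqi
    refine lt_of_le_of_lt (le_of_tendsto (hρ m q) ?_) (sub_lt_self _ (hpos n))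
    filter_upwards [eventually_ge_atTop (i m n).2] with t ht
    exact ((hi m n t).2 ht q ((hi m n t).1 hqi)).1 hqi
  have hout : ∀ m n q, q ∈ D n → q ∉ (i m n).1 → (1 / 2) ^ m - 2 / ((n : ℝ) + 1) ≤ ρ m q := by
    intro m n q hqD hqi
    refine ge_of_tendsto (hρ m q) ?_
    filter_upwards [eventually_ge_atTop (i m n).2] with t ht
    exact ((hi m n t).2 ht q hqD).2 hqi
  refine ⟨spectralSet hω hq hb, fun m => gridSet m (pseudoIndices (koopman F ω) m),
    fun m n => gridSet m ((i m n).1.image Prod.fst), rfl, fun m n => ?_, fun m => ?_,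
    tendsto_gridSet rfl (one_mem_approxPointSpectrum hω hq hb),
    fun m => subset_gridSet_add_closedBall m⟩
  · exact tendsto_const_nhds.congr' ((hlim m n).mono fun k hk => by simp only [hk])
  · have hev : ∀ᶠ n in atTop,
        (i m n).1.image Prod.fst = pseudoIndices (koopman F ω) m := by
      refine eventually_eq_of_forall_mem (fun n p hp => ?_) fun p hp => ?_
      · obtain ⟨q, hqi, rfl⟩ := Finset.mem_image.1 hp
        exact mem_pseudoIndices.2 ((hg _ _ _).2 ⟨q.2, hin m n q hqi⟩)
      · obtain ⟨l, hl⟩ := (hg _ _ _).1 (mem_pseudoIndices.1 hp)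
        have hl' : ρ m (p, l) < (1 / 2) ^ m := hl
        have hto : Tendsto (fun n : ℕ => 2 * (1 / ((n : ℝ) + 1))) atTop (𝓝 (2 * 0)) :=
          tendsto_one_div_add_atTop_nhds_zero_nat.const_mul 2
        rw [mul_zero] at hto
        filter_upwards [eventually_mem_box p, eventually_ge_atTop l,
          hto.eventually (gt_mem_nhds (sub_pos.2 hl'))] with n hn₁ hn₂ hn₃
        refine Finset.mem_image.2 ⟨(p, l), ?_, rfl⟩
        by_contra hnot
        have := hout m n (p, l)
          (Finset.mk_mem_product hn₁ (Finset.mem_range.2 (Nat.lt_succ_of_le hn₂))) hnot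
        rw [mul_one_div] at hn₃
        linarith
    exact tendsto_const_nhds.congr' (hev.mono fun n hn => by simp only [hn])

theorem exists_algorithms_measurePreservingClass (ω : Measure X) [IsFiniteMeasure ω]
    (hω : ω ≠ 0) :
    ∃ Γ : ℕ → ℕ → (X → ℕ → X) → NonemptyCompacts ℂ,
      (∀ n₂ n₁, IsGeneralAlgorithm (MeasurePreservingClass ω) (Γ n₂ n₁)) ∧
      ∀ F ∈ MeasurePreservingClass ω, ∀ y, IsSnapshotData F y →
        ∃ (S : NonemptyCompacts ℂ) (G : ℕ → NonemptyCompacts ℂ),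
          (S : Set ℂ) = approxPointSpectrum (koopman F ω) ∧
          (∀ n₂, Tendsto (fun n₁ => Γ n₂ n₁ y) atTop (𝓝 (G n₂))) ∧
          Tendsto G atTop (𝓝 S) ∧
          ∀ n₂, (G n₂ : Set ℂ) ⊆ (S : Set ℂ) + Metric.closedBall (0 : ℂ) ((1 / 2 : ℝ) ^ n₂) := by
  classical
  have : NeZero ω := ⟨hω⟩
  have : Nonempty X := Measure.nonempty_of_neZero ω
  obtain ⟨g, hg⟩ := exists_witness_family hω
  let pt : ℕ → ℂ := denseSeq ℂ
  let r : ℕ → ℕ → ℕ → (X → ℕ → X) → ℝ := fun i l t y => quadResidual ω (g l) (pt i) t y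
  let D : ℕ → Finset (ℕ × ℕ × ℕ) := fun n =>
    Finset.range (n + 1) ×ˢ Finset.range (n + 1) ×ˢ Finset.range (n + 1)
  -- a witness `(A, N)` consists of points that are, from stage `N` on, certified to be close to
  -- the spectrum, and that cover the coarser approximations of the spectrum up to level `n`
  let R : ℕ → Finset (ℕ × ℕ) × ℕ → ℕ → (X → ℕ → X) → Prop := fun n w t y =>
    w.2 ≤ t → (∀ a ∈ w.1, r a.1 a.2 t y ≤ (1 / 2) ^ (n + 1)) ∧
      ∀ b ∈ D n, (∃ a ∈ w.1, dist (pt b.1) (pt a.1) ≤ 2 * (1 / 2) ^ b.2.1) ∨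
        (1 / 2) ^ b.2.1 / 2 ≤ r b.1 b.2.2 t y
  have hR : ∀ n w t, ReadsOnly (nodeReads X t) (R n w t) := by
    intro n w t y y' h
    have hr : ∀ i l, r i l t y = r i l t y' := fun i l =>
      quadResidual_readsOnly ω (g l) (pt i) t y y' h
    simp only [R, hr]
  choose s hsread hs using fun n => exists_limit_search (R n) (nodeReads X) (hR n)
  refine ⟨fun n k y => finiteWithOne ((s n k y).1.image fun a => pt a.1), fun n k => ?_,
    fun F hF y hy => ?_⟩
  · obtain ⟨p, hp, hread⟩ := hsread n k
    exact (hread.comp fun w => finiteWithOne (w.1.image fun a => pt a.1)).isGeneralAlgorithm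
      ((nodeReads_nonempty k).mono hp) _
  have hq : Measure.QuasiMeasurePreserving F ω ω := hF.2.quasiMeasurePreserving
  have hb : KoopmanBounded F ω := koopmanBounded_of_measurePreserving hF.2
  have h1 := one_mem_approxPointSpectrum hω hq hb
  have hclose : ∀ {z c}, IsPseudoEigenvalue (koopman F ω) z c →
      ∃ w ∈ approxPointSpectrum (koopman F ω), dist z w < c := fun h =>
    exists_dist_lt_of_isometry (norm_koopman_of_measurePreserving hF.2) h
  let ρ : ℕ → ℕ → ℝ := fun i l =>
    ‖koopman F ω (ContinuousMap.toLp 2 ω ℂ (g l)) - pt i • ContinuousMap.toLp 2 ω ℂ (g l)‖ /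
      ‖ContinuousMap.toLp 2 ω ℂ (g l)‖
  have hρ : ∀ i l, Tendsto (fun t => r i l t y) atTop (𝓝 (ρ i l)) := fun i l =>
    tendsto_quadResidual ⟨hF.1, hq, hb⟩ hy (g l) (pt i)
  have hdense : ∀ (z : ℂ) (ε : ℝ), 0 < ε → ∃ i, dist z (pt i) < ε := fun z ε hε =>
    (denseRange_denseSeq ℂ).exists_dist_lt z hε
  have hex : ∀ n, ∃ w, ∀ t, R n w t y := by
    intro n
    -- A triple `b` is (point, level, test function). If its residual is below its level, a spectral
    -- point `w` is that close, and a dense point near `w` carries a certificate at level `n + 1`;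
    -- the two distances give the factor 2.
    have hA : ∀ b : ℕ × ℕ × ℕ, ∃ A : Finset (ℕ × ℕ),
        (∀ a ∈ A, ρ a.1 a.2 < (1 / 2) ^ (n + 1)) ∧
        ((∃ a ∈ A, dist (pt b.1) (pt a.1) ≤ 2 * (1 / 2) ^ b.2.1) ∨
          (1 / 2) ^ b.2.1 ≤ ρ b.1 b.2.2) := by
      intro b
      by_cases hb : ρ b.1 b.2.2 < (1 / 2) ^ b.2.1
      · obtain ⟨w, hw, hd⟩ := hclose ((hg _ _ _).2 ⟨b.2.2, hb⟩)
        obtain ⟨j, hj⟩ := hdense w (min ((1 / 2) ^ b.2.1) ((1 / 2) ^ (n + 1))) (by positivity)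
        obtain ⟨l, hl⟩ := (hg _ _ _).1
          (isPseudoEigenvalue_of_dist_lt hw (hj.trans_le (min_le_right _ _)))
        refine ⟨{(j, l)}, fun a ha => ?_, Or.inl ⟨(j, l), Finset.mem_singleton_self _, ?_⟩⟩
        · rw [Finset.mem_singleton.1 ha]
          exact hl
        · have h2 := dist_triangle (pt b.1) w (pt j)
          have h3 := hj.trans_le (min_le_left _ _)
          change dist (pt b.1) (pt j) ≤ _
          linarith
      · exact ⟨∅, by simp, Or.inr (not_lt.1 hb)⟩
    choose A hA₁ hA₂ using hA
    let A' := (D n).biUnion A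
    have hev : ∀ᶠ t in atTop, (∀ a ∈ A', r a.1 a.2 t y ≤ (1 / 2) ^ (n + 1)) ∧
        ∀ b ∈ D n, (∃ a ∈ A', dist (pt b.1) (pt a.1) ≤ 2 * (1 / 2) ^ b.2.1) ∨
          (1 / 2) ^ b.2.1 / 2 ≤ r b.1 b.2.2 t y := by
      refine ((Finset.eventually_all _).2 fun a ha => ?_).and
        ((Finset.eventually_all _).2 fun b hb => ?_)
      · obtain ⟨b, -, hab⟩ := Finset.mem_biUnion.1 ha
        exact ((hρ a.1 a.2).eventually (gt_mem_nhds (hA₁ b a hab))).mono fun t ht => ht.le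
      · rcases hA₂ b with ⟨a, ha, hd⟩ | hle
        · exact Eventually.of_forall fun t => Or.inl ⟨a, Finset.mem_biUnion.2 ⟨b, hb, ha⟩, hd⟩
        · have hlt : (1 / 2) ^ b.2.1 / 2 < ρ b.1 b.2.2 :=
            (half_lt_self (by positivity)).trans_le hle
          exact ((hρ b.1 b.2.2).eventually (lt_mem_nhds hlt)).mono fun t ht => Or.inr ht.le
    obtain ⟨N, hN⟩ := eventually_atTop.1 hev
    exact ⟨(A', N), fun t ht => hN t ht⟩
  choose w hw hlim using fun n => hs n y (hex n)
  have hnear : ∀ n, ∀ x ∈ finiteWithOne ((w n).1.image fun a => pt a.1),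
      ∃ z ∈ spectralSet hω hq hb, dist x z ≤ (1 / 2) ^ n := by
    intro n x hx
    rcases mem_finiteWithOne.1 hx with rfl | hx
    · exact ⟨1, h1, by simp⟩
    obtain ⟨a, ha, rfl⟩ := Finset.mem_image.1 hx
    have hle : ρ a.1 a.2 ≤ (1 / 2) ^ (n + 1) := by
      refine le_of_tendsto (hρ a.1 a.2) ?_
      filter_upwards [eventually_ge_atTop (w n).2] with t ht
      exact (hw n t ht).1 a ha
    have hlt : ρ a.1 a.2 < (1 / 2) ^ n :=
      hle.trans_lt (pow_lt_pow_right_of_lt_one₀ (by norm_num) (by norm_num) (Nat.lt_succ_self n))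
    obtain ⟨z, hz, hd⟩ := hclose ((hg _ _ _).2 ⟨a.2, hlt⟩)
    exact ⟨z, hz, hd.le⟩
  refine ⟨spectralSet hω hq hb, fun n => finiteWithOne ((w n).1.image fun a => pt a.1), rfl,
    fun n => tendsto_const_nhds.congr' ((hlim n).mono fun k hk => by simp only [hk]), ?_,
    fun n x hx => ?_⟩
  · have hpow : ∀ ε > (0 : ℝ), ∃ m : ℕ, ∀ n ≥ m, (1 / 2 : ℝ) ^ n < ε := fun ε hε =>
      eventually_atTop.1 ((tendsto_pow_atTop_nhds_zero_of_lt_one (by norm_num)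
        (by norm_num)).eventually (gt_mem_nhds hε))
    refine tendsto_nonemptyCompacts_of_dist (fun ε hε => ?_) fun z hz ε hε => ?_
    · obtain ⟨m, hm⟩ := hpow ε hε
      filter_upwards [eventually_ge_atTop m] with n hn x hx
      obtain ⟨z, hz, hd⟩ := hnear n x hx
      exact ⟨z, hz, hd.trans (hm n hn).le⟩
    -- The residual at `pt i` is below `2⁻ᵏ / 2`, which excludes the second alternative of `R`. The
    -- total distance is `2⁻ᵏ / 2 + 2 * 2⁻ᵏ < 3 * 2⁻ᵏ < ε`.
    · obtain ⟨k, hk⟩ := hpow (ε / 3) (by positivity)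
      obtain ⟨i, hi⟩ := hdense z ((1 / 2) ^ k / 2) (by positivity)
      obtain ⟨l, hl⟩ := (hg _ _ _).1
        (isPseudoEigenvalue_of_dist_lt ((mem_spectralSet hω hq hb).1 hz) hi)
      filter_upwards [eventually_ge_atTop i, eventually_ge_atTop k, eventually_ge_atTop l]
        with n hni hnk hnl
      have hbD : (i, k, l) ∈ D n := Finset.mk_mem_product
        (Finset.mem_range.2 (Nat.lt_succ_of_le hni)) (Finset.mk_mem_product
          (Finset.mem_range.2 (Nat.lt_succ_of_le hnk)) (Finset.mem_range.2 (Nat.lt_succ_of_le hnl)))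
      obtain ⟨a, ha, hd⟩ :
          ∃ a ∈ (w n).1, dist (pt i) (pt a.1) ≤ 2 * (1 / 2) ^ k := by
        by_contra hnot
        refine absurd hl (not_lt.2 (ge_of_tendsto (hρ i l) ?_))
        filter_upwards [eventually_ge_atTop (w n).2] with t ht
        exact ((hw n t ht).2 (i, k, l) hbD).resolve_left hnot
      refine ⟨pt a.1, mem_finiteWithOne.2 (Or.inr (Finset.mem_image.2 ⟨a, ha, rfl⟩)), ?_⟩
      have h2 := dist_triangle z (pt i) (pt a.1)
      have h3 := hk k le_rfl
      have h4 : (0 : ℝ) < (1 / 2) ^ k := by positivity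
      linarith
  · obtain ⟨z, hz, hd⟩ := hnear n x hx
    refine Set.mem_add.2 ⟨z, hz, x - z, ?_, add_sub_cancel _ _⟩
    rwa [mem_closedBall_zero_iff, ← dist_eq_norm]

end Quadrature

end KoopmanSCI

theorem theorem2 {X : Type*} [MetricSpace X] [CompactSpace X] [MeasurableSpace X] [BorelSpace X]
    (ω : Measure X) [IsFiniteMeasure ω] (hω : ω ≠ 0) :
    -- two limits, covering from above in the last limit, for a known modulus of continuity
    (∀ α : ℝ≥0 → ℝ≥0, Monotone α → Continuous α → α 0 = 0 →
      ∃ Γ : ℕ → ℕ → (X → ℕ → X) → NonemptyCompacts ℂ,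
        (∀ n₂ n₁, KoopmanSCI.IsGeneralAlgorithm (KoopmanSCI.ModulusClass ω α) (Γ n₂ n₁)) ∧
        ∀ F ∈ KoopmanSCI.ModulusClass ω α, ∀ y, KoopmanSCI.IsSnapshotData F y →
          ∃ (S : NonemptyCompacts ℂ) (G : ℕ → NonemptyCompacts ℂ),
            (S : Set ℂ) = KoopmanSCI.approxPointSpectrum (KoopmanSCI.koopman F ω) ∧
            (∀ n₂, Tendsto (fun n₁ => Γ n₂ n₁ y) atTop (𝓝 (G n₂))) ∧
            Tendsto G atTop (𝓝 S) ∧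
            ∀ n₂, (S : Set ℂ) ⊆ (G n₂ : Set ℂ) + Metric.closedBall (0 : ℂ) ((1 / 2 : ℝ) ^ n₂)) ∧
    -- two limits, contained from below in the last limit, for measure-preserving maps
    (∃ Γ : ℕ → ℕ → (X → ℕ → X) → NonemptyCompacts ℂ,
        (∀ n₂ n₁, KoopmanSCI.IsGeneralAlgorithm (KoopmanSCI.MeasurePreservingClass ω)
          (Γ n₂ n₁)) ∧
        ∀ F ∈ KoopmanSCI.MeasurePreservingClass ω, ∀ y, KoopmanSCI.IsSnapshotData F y →
          ∃ (S : NonemptyCompacts ℂ) (G : ℕ → NonemptyCompacts ℂ),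
            (S : Set ℂ) = KoopmanSCI.approxPointSpectrum (KoopmanSCI.koopman F ω) ∧
            (∀ n₂, Tendsto (fun n₁ => Γ n₂ n₁ y) atTop (𝓝 (G n₂))) ∧
            Tendsto G atTop (𝓝 S) ∧
            ∀ n₂, (G n₂ : Set ℂ) ⊆ (S : Set ℂ) + Metric.closedBall (0 : ℂ) ((1 / 2 : ℝ) ^ n₂)) ∧
    -- three limits, covering from above in the last limit, for general continuous maps
    (∃ Γ : ℕ → ℕ → ℕ → (X → ℕ → X) → NonemptyCompacts ℂ,
        (∀ n₃ n₂ n₁, KoopmanSCI.IsGeneralAlgorithm (KoopmanSCI.ContinuousClass ω)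
          (Γ n₃ n₂ n₁)) ∧
        ∀ F ∈ KoopmanSCI.ContinuousClass ω, ∀ y, KoopmanSCI.IsSnapshotData F y →
          ∃ (S : NonemptyCompacts ℂ) (G : ℕ → NonemptyCompacts ℂ)
            (G' : ℕ → ℕ → NonemptyCompacts ℂ),
            (S : Set ℂ) = KoopmanSCI.approxPointSpectrum (KoopmanSCI.koopman F ω) ∧
            (∀ n₃ n₂, Tendsto (fun n₁ => Γ n₃ n₂ n₁ y) atTop (𝓝 (G' n₃ n₂))) ∧
            (∀ n₃, Tendsto (fun n₂ => G' n₃ n₂) atTop (𝓝 (G n₃))) ∧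
            Tendsto G atTop (𝓝 S) ∧
            ∀ n₃, (S : Set ℂ) ⊆ (G n₃ : Set ℂ) + Metric.closedBall (0 : ℂ) ((1 / 2 : ℝ) ^ n₃)) := by
  exact ⟨KoopmanSCI.exists_algorithms_modulusClass ω hω,
    KoopmanSCI.exists_algorithms_measurePreservingClass ω hω,
    KoopmanSCI.exists_algorithms_continuousClass ω hω⟩
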